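/- Let $g\in C^1(\mathbb R^n)$ and let $u(x,t)=\min_{|x-y|\le t}g(y)$, $(x,t)\in\mathbb R^n\times[0,\infty)$, be the Hopf--Lax solution of the Eikonal equation $u_t+|\nabla u|=0$, $u(\cdot,0)=g$. A point $y$ with $|y-x|\le t$ and $g(y)=u(x,t)$ is called a minimizer for $(x,t)$. A point $(x,t)$ is called a differentiable point if $u$, as a function of $(x,t)$ on $\mathbb R^n\times[0,\infty)$, is differentiable at $(x,t)$ (at $t=0$: differentiable up to the boundary), and a nondifferentiable point otherwise. For $y_0$ with $Dg(y_0)\ne0$ put $x(t)=y_0+t\,\frac{Dg(y_0)}{|Dg(y_0)|}$ and $$\overline t_s(y_0)=\sup\{t>0: y_0\text{ is the unique minimizer for }(x(t),t)\},\qquad t_s(y_0)=\inf\{t>0: y_0\text{ is not a minimizer for }(x(t),t)\},$$ with values in $[0,\infty]$, where $\sup\emptyset=0$ and $\inf\emptyset=\infty$. Let $y_0\in\mathbb R^n$ be such that $Dg(y_0)\ne0$ and $\overline t_s(y_0)<\infty$. 1. Suppose $\overline t_s(y_0)=t_s(y_0)$, write $t_s=t_s(y_0)$ and $x_s=x(t_s)$.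 Then either $(x_s,t_s)$ has a unique minimizer and is a differentiable point, or it has more than one minimizer and is a nondifferentiable point. Furthermore, if $(x_s,t_s)$ is a differentiable point, or a nondifferentiable point all of whose minimizers $y$ satisfy $Dg(y)\ne0$, then there exists $h>0$ such that for every $\epsilon\in(0,h]$ there is a point $x_\epsilon$ with $|x_\epsilon-x_s|<\epsilon$ such that $(x_\epsilon,t_s+\epsilon)$ is a nondifferentiable point. 2. Suppose $\overline t_s(y_0)<t_s(y_0)$. Then $(x(t),t)$ is a nondifferentiable point for every $t\in[\overline t_s(y_0),t_s(y_0)]$ (for every $t\in[\overline t_s(y_0),\infty)$ if $t_s(y_0)=\infty$). -/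

import Mathlib

open Set
open scoped NNReal ENNReal Gradient

namespace Eikonal

variable {n : ℕ}

/-- The Hopf-Lax solution `u(x, t) = min_{|x - y| ≤ t} g(y)` of the Eikonal equation
`u_t + |∇u| = 0` on `ℝⁿ × [0, ∞)` with `u(·, 0) = g`. Values at `t < 0` carry no meaning. -/
noncomputable def hopfLax (g : EuclideanSpace ℝ (Fin n) → ℝ)
    (x : EuclideanSpace ℝ (Fin n)) (t : ℝ) : ℝ :=
  sInf (g '' Metric.closedBall x t)

/-- For continuous `g` and `t ≥ 0` the infimum is a minimum. -/
theorem hopfLax_isLeast {g : EuclideanSpace ℝ (Fin n) → ℝ} (hg : Continuous g)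
    (x : EuclideanSpace ℝ (Fin n)) {t : ℝ} (ht : 0 ≤ t) :
    IsLeast (g '' Metric.closedBall x t) (hopfLax g x t) :=
  ((isCompact_closedBall x t).image hg).isLeast_sInf
    ((Metric.nonempty_closedBall.mpr ht).image g)

/-- The set `L(x, t)` of minimizers for `(x, t)`. -/
def minimizers (g : EuclideanSpace ℝ (Fin n) → ℝ)
    (x : EuclideanSpace ℝ (Fin n)) (t : ℝ) : Set (EuclideanSpace ℝ (Fin n)) :=
  {y | y ∈ Metric.closedBall x t ∧ hopfLax g x t = g y}

/-- The space component `y + t Dg(y)/|Dg(y)|` at time `t` of the characteristic from a point `y`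
with `Dg(y) ≠ 0`. -/
noncomputable def charPoint (g : EuclideanSpace ℝ (Fin n) → ℝ)
    (y : EuclideanSpace ℝ (Fin n)) (t : ℝ) : EuclideanSpace ℝ (Fin n) :=
  y + t • (‖∇ g y‖⁻¹ • ∇ g y)

/-- The first termination time: the supremum in `[0, ∞]` of the times `t > 0` at which `y` is
the unique minimizer for the point at time `t` of the characteristic from `y`
(it is `0` if there is no such time). -/
noncomputable def firstTerminationTime (g : EuclideanSpace ℝ (Fin n) → ℝ)
    (y : EuclideanSpace ℝ (Fin n)) : ℝ≥0∞ :=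
  sSup {T : ℝ≥0∞ | ∃ t : ℝ≥0, T = t ∧ 0 < t ∧ minimizers g (charPoint g y t) t = {y}}

/-- The second termination time: the infimum in `[0, ∞]` of the times `t > 0` at which `y` is
not a minimizer for the point at time `t` of the characteristic from `y`
(it is `∞` if there is no such time). -/
noncomputable def secondTerminationTime (g : EuclideanSpace ℝ (Fin n) → ℝ)
    (y : EuclideanSpace ℝ (Fin n)) : ℝ≥0∞ :=
  sInf {T : ℝ≥0∞ | ∃ t : ℝ≥0, T = t ∧ 0 < t ∧ y ∉ minimizers g (charPoint g y t) t}

/-- `(x, t)` is a differentiable point of the solution `u`, as a function of `(x, t)` on its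
domain `ℝⁿ × [0, ∞)`. For `t > 0` this is ordinary differentiability, for `t = 0` it is
differentiability up to the boundary. -/
def IsDifferentiablePoint (g : EuclideanSpace ℝ (Fin n) → ℝ)
    (x : EuclideanSpace ℝ (Fin n)) (t : ℝ) : Prop :=
  DifferentiableWithinAt ℝ (fun p : EuclideanSpace ℝ (Fin n) × ℝ => hopfLax g p.1 p.2)
    {p | 0 ≤ p.2} (x, t)

end Eikonal

/-!
Two facts relate differentiability of `u` at `(x, t)` to minimizers. If there is a single
minimizer, `u` is differentiable: `u(x, t)` is the minimum of `g (x + t v)` over the fixed unit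
ball, and a minimum over a compact parameter set is differentiable where its active parameters
have the same derivative (Danskin; `hasFDerivWithinAt_sInf_image`, in a one-sided form that
includes `t = 0`). Conversely, at a differentiable point the spatial gradient of `u` is `∇ g y` for
*every* minimizer `y`, while a minimizer with `∇ g y ≠ 0` is determined by that gradient, since
`x = charPoint g y t` by the Lagrange rule. Hence a differentiable point with a noncritical
minimizer has no other minimizer (`IsDifferentiablePoint.minimizers_eq_singleton`).

Along the characteristic from `y₀` the balls are strictly nested away from `y₀`. So `y₀` stays a
minimizer up to the second termination time, and competing minimizers at earlier times are
critical points of `g`. This gives nondifferentiability between the two termination times; at the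
first one itself, critical competitors at slightly later times accumulate at a critical
minimizer, which is not `y₀`.

For the propagation of nondifferentiability from `(xₛ, tₛ)`, suppose that all points at time
`tₛ + ε` over the ball of radius `ε` around `xₛ` are differentiable. For small `ε` their minimizers
are noncritical, so `u(·, tₛ + ε)` has nonvanishing gradient there. For `r < ε` let `x` be a maximum
point of `u(·, tₛ + ε)` over the closed ball of radius `r`. The gradient at `x` is radial, so
the characteristic arriving at `x` passes through `xₛ` at time `tₛ + ε - r`, and
`u(xₛ, tₛ + ε - r) ≤ u(x, tₛ + ε)`. Letting `r → ε` yields a point `x'` of the closed ball with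
`u(x', tₛ + ε) ≥ u(xₛ, tₛ) = g y₀`. Then `y₀` is a minimizer for `(x', tₛ + ε)`, so its characteristic
survives beyond `tₛ`, a contradiction. Choosing a maximum point takes the place of a topological
fixed point argument for the map `x ↦ xₛ + r ∇u/|∇u|`.
-/

namespace Eikonal

open Filter Topology Metric

/-! ### Differentiating a minimum over a compact set -/

/-- Danskin's theorem, relative to a set `S` of admissible points: `q ↦ min_{v ∈ K} f q v` has
derivative `ℓ` at `q₀` within `S` if `ℓ` is the derivative of one active branch and is, in the
directions of `S`, at most the derivative of every active branch. -/
theorem hasFDerivWithinAt_sInf_image {E V : Type*} [NormedAddCommGroup E] [NormedSpace ℝ E]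
    [TopologicalSpace V] {K : Set V} (hK : IsCompact K) {f : E → V → ℝ}
    {f' : E → V → E →L[ℝ] ℝ} (hf : Continuous ↿f) (hf' : Continuous ↿f')
    (hd : ∀ q v, HasFDerivAt (fun q => f q v) (f' q v) q) {q₀ : E} {S : Set E}
    {ℓ : E →L[ℝ] ℝ} {v₀ : V} (hv₀ : v₀ ∈ K) (hmin : f q₀ v₀ = sInf (f q₀ '' K))
    (hℓ : f' q₀ v₀ = ℓ)
    (hge : ∀ v ∈ K, f q₀ v = sInf (f q₀ '' K) → ∀ q ∈ S, ℓ (q - q₀) ≤ f' q₀ v (q - q₀)) :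
    HasFDerivWithinAt (fun q => sInf (f q '' K)) ℓ S q₀ := by
  have hfc (q : E) : Continuous (f q) := hf.comp (Continuous.prodMk_right q)
  have hleast (q : E) : IsLeast (f q '' K) (sInf (f q '' K)) :=
    (hK.image (hfc q)).isLeast_sInf ⟨_, v₀, hv₀, rfl⟩
  have hu : Continuous fun q => sInf (f q '' K) := hK.continuous_sInf hf
  rw [hasFDerivWithinAt_iff_isLittleO, Asymptotics.isLittleO_iff]
  intro c hc
  have hδ : 0 < c / 3 := by positivity
  have hunif : ∀ᶠ q in 𝓝 q₀, ∀ v ∈ K, ‖f' q v - f' q₀ v‖ < c / 3 := by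
    refine hK.eventually_forall_of_forall_eventually fun v _ => ?_
    have hcont : Continuous fun z : E × V => ‖f' z.1 z.2 - f' q₀ z.2‖ :=
      (hf'.sub (hf'.comp (Continuous.prodMk continuous_const continuous_snd))).norm
    exact hcont.tendsto (q₀, v) |>.eventually_lt_const (by simpa using hδ)
  -- parameters active at `q` are close, in terms of `f' q₀`, to parameters active at `q₀`
  have hnear : ∀ᶠ q in 𝓝 q₀, ∀ v ∈ K, f q v = sInf (f q '' K) →
      ∃ w ∈ K, f q₀ w = sInf (f q₀ '' K) ∧ ‖f' q₀ v - f' q₀ w‖ < c / 3 := by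
    refine hK.eventually_forall_of_forall_eventually fun v hv => ?_
    by_cases hvm : f q₀ v = sInf (f q₀ '' K)
    · have hcont : Continuous fun z : E × V => ‖f' q₀ z.2 - f' q₀ v‖ :=
        ((hf'.comp (Continuous.prodMk continuous_const continuous_snd)).sub continuous_const).norm
      have hlt : ∀ᶠ z : E × V in 𝓝 (q₀, v), ‖f' q₀ z.2 - f' q₀ v‖ < c / 3 :=
        hcont.tendsto (q₀, v) |>.eventually_lt_const (by simpa using hδ)
      filter_upwards [hlt] with z hz _
      exact ⟨v, hv, hvm, hz⟩
    · have hne : ∀ᶠ z : E × V in 𝓝 (q₀, v), f z.1 z.2 ≠ sInf (f z.1 '' K) :=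
        (isOpen_ne_fun hf (hu.comp continuous_fst)).mem_nhds hvm
      filter_upwards [hne] with z hz h
      exact absurd h hz
  obtain ⟨ρ, hρ, hball⟩ := Metric.eventually_nhds_iff_ball.1 hunif
  -- the first-order expansion of `f · v` at `q₀` holds with an error uniform in `v`
  have hmvt : ∀ q ∈ ball q₀ ρ, ∀ v ∈ K,
      ‖f q v - f q₀ v - f' q₀ v (q - q₀)‖ ≤ c / 3 * ‖q - q₀‖ := fun q hq v hv =>
    (convex_ball q₀ ρ).norm_image_sub_le_of_norm_hasFDerivWithin_le'
      (fun p _ => (hd p v).hasFDerivWithinAt) (fun p hp => (hball p hp v hv).le)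
      (mem_ball_self hρ) hq
  filter_upwards [nhdsWithin_le_nhds (ball_mem_nhds q₀ hρ), nhdsWithin_le_nhds hnear,
    self_mem_nhdsWithin] with q hq hqn hqS
  have hnn := norm_nonneg (q - q₀)
  rw [Real.norm_eq_abs, abs_le]
  constructor
  · obtain ⟨v, hv, hvq⟩ := (hleast q).1
    obtain ⟨w, hw, hwm, hvw⟩ := hqn v hv hvq
    have h1 := (abs_le.1 (hmvt q hq v hv)).1
    have h2 := (hleast q₀).2 ⟨v, hv, rfl⟩
    have h3 := hge w hw hwm q hqS
    have h4 := (abs_le.1 (((f' q₀ v - f' q₀ w).le_opNorm (q - q₀)).trans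
      (mul_le_mul_of_nonneg_right hvw.le hnn))).1
    rw [sub_apply] at h4
    nlinarith
  · have h1 := (abs_le.1 (hmvt q hq v₀ hv₀)).2
    have h2 := (hleast q).2 ⟨v₀, hv₀, rfl⟩
    rw [hℓ] at h1
    nlinarith

/-! ### Minimizers -/

variable {n : ℕ} {g : EuclideanSpace ℝ (Fin n) → ℝ} {x y z : EuclideanSpace ℝ (Fin n)} {s t : ℝ}

theorem hopfLax_le (hg : Continuous g) (hy : y ∈ closedBall x t) : hopfLax g x t ≤ g y :=
  (hopfLax_isLeast hg x (dist_nonneg.trans hy)).2 ⟨y, hy, rfl⟩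

theorem minimizers_nonempty (hg : Continuous g) (ht : 0 ≤ t) : (minimizers g x t).Nonempty :=
  let ⟨y, hy, h⟩ := (hopfLax_isLeast hg x ht).1
  ⟨y, hy, h.symm⟩

theorem mem_minimizers_iff (hg : Continuous g) :
    y ∈ minimizers g x t ↔ y ∈ closedBall x t ∧ ∀ z ∈ closedBall x t, g y ≤ g z := by
  refine ⟨fun h => ⟨h.1, fun z hz => h.2 ▸ hopfLax_le hg hz⟩, fun h => ⟨h.1, ?_⟩⟩
  obtain ⟨z, hz, hzu⟩ := (hopfLax_isLeast hg x (dist_nonneg.trans h.1)).1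
  exact le_antisymm (hopfLax_le hg h.1) (hzu ▸ h.2 z hz)

theorem closedBall_eq_image (x : EuclideanSpace ℝ (Fin n)) (ht : 0 ≤ t) :
    closedBall x t = (fun v => x + t • v) '' closedBall 0 1 := by
  rw [← affinity_unitClosedBall ht x, ← Set.image_smul, ← Set.image_vadd, Set.image_image]
  rfl

/-- Rescaling the ball to the unit ball exhibits the Hopf-Lax solution as a minimum over a set
that does not depend on `(x, t)`. -/
theorem hopfLax_eq_sInf (x : EuclideanSpace ℝ (Fin n)) (ht : 0 ≤ t) :
    hopfLax g x t = sInf ((fun v => g (x + t • v)) '' closedBall 0 1) := by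
  rw [hopfLax, closedBall_eq_image x ht, Set.image_image]

theorem continuous_sInf_unitBall (hg : Continuous g) :
    Continuous fun p : EuclideanSpace ℝ (Fin n) × ℝ =>
      sInf ((fun v => g (p.1 + p.2 • v)) '' closedBall 0 1) :=
  (isCompact_closedBall _ _).continuous_sInf
    (f := fun (p : EuclideanSpace ℝ (Fin n) × ℝ) v => g (p.1 + p.2 • v))
    (by simp only [Function.HasUncurry.uncurry, id]; fun_prop)

theorem continuousOn_hopfLax (hg : Continuous g) :
    ContinuousOn (fun p : EuclideanSpace ℝ (Fin n) × ℝ => hopfLax g p.1 p.2) {p | 0 ≤ p.2} :=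
  (continuous_sInf_unitBall hg).continuousOn.congr fun p hp => hopfLax_eq_sInf p.1 hp

theorem continuous_gradient (hg : ContDiff ℝ 1 g) : Continuous (∇ g) :=
  (InnerProductSpace.toDual ℝ _).symm.continuous.comp (hg.continuous_fderiv one_ne_zero)

/-- Lagrange multiplier rule on a ball: at a minimum with nonzero gradient, the gradient points
from the minimum to the centre, and the minimum lies on the sphere. -/
theorem eq_add_of_isMinOn_closedBall {f : EuclideanSpace ℝ (Fin n) → ℝ}
    {p : EuclideanSpace ℝ (Fin n)} (hf : HasGradientAt f p y) (hp : p ≠ 0)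
    (hy : y ∈ closedBall x t) (hmin : IsMinOn f (closedBall x t) y) :
    x = y + t • (‖p‖⁻¹ • p) := by
  have ht : 0 ≤ t := dist_nonneg.trans hy
  have hp' : 0 < ‖p‖ := norm_pos_iff.2 hp
  set ν := ‖p‖⁻¹ • p with hν
  have hν1 : ‖ν‖ = 1 := norm_smul_inv_norm hp
  have hpν : p = ‖p‖ • ν := by rw [hν, smul_smul, mul_inv_cancel₀ hp'.ne', one_smul]
  have hw : x - t • ν ∈ closedBall x t := by
    simp [norm_smul, hν1, abs_of_nonneg ht]
  have h0 := hmin.localize.hasFDerivWithinAt_nonneg hf.hasFDerivAt.hasFDerivWithinAt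
    (sub_mem_posTangentConeAt_of_segment_subset ((convex_closedBall x t).segment_subset hy hw))
  have h1 : 0 ≤ inner ℝ p (x - t • ν - y) := by simpa using h0
  have h2 : t ≤ inner ℝ ν (x - y) := by
    rw [hpν, inner_smul_left, show x - t • ν - y = (x - y) - t • ν by abel, inner_sub_right,
      inner_smul_right, real_inner_self_eq_norm_sq, hν1] at h1
    have := nonneg_of_mul_nonneg_right h1 hp'
    linarith
  have h3 : ‖x - y‖ ≤ t := by rwa [mem_closedBall, dist_comm, dist_eq_norm] at hy
  have h4 : ‖(x - y) - t • ν‖ ^ 2 ≤ 0 := by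
    rw [norm_sub_sq_real, inner_smul_right, real_inner_comm, norm_smul, hν1, Real.norm_eq_abs,
      mul_one, sq_abs]
    nlinarith [norm_nonneg (x - y)]
  have h5 : (x - y) - t • ν = 0 := norm_eq_zero.1 (pow_eq_zero_iff two_ne_zero |>.1
    (le_antisymm h4 (sq_nonneg _)))
  rw [← sub_eq_zero.1 h5]; abel

theorem hasGradientAt (hg : ContDiff ℝ 1 g) (y : EuclideanSpace ℝ (Fin n)) :
    HasGradientAt g (∇ g y) y :=
  (hg.differentiable one_ne_zero y).hasGradientAt

theorem eq_charPoint_of_mem_minimizers (hg : ContDiff ℝ 1 g) (hy : y ∈ minimizers g x t)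
    (h0 : ∇ g y ≠ 0) : x = charPoint g y t :=
  eq_add_of_isMinOn_closedBall (hasGradientAt hg y) h0 hy.1
    ((mem_minimizers_iff hg.continuous).1 hy).2

theorem gradient_eq_zero_of_mem_ball (hg : ContDiff ℝ 1 g) (hy : y ∈ minimizers g x t)
    (hb : y ∈ ball x t) : ∇ g y = 0 := by
  have hloc : IsLocalMin g y := by
    filter_upwards [isOpen_ball.mem_nhds hb] with z hz
    exact ((mem_minimizers_iff hg.continuous).1 hy).2 z (ball_subset_closedBall hz)
  simp [gradient, hloc.fderiv_eq_zero]

theorem dist_charPoint (h0 : ∇ g y ≠ 0) (s t : ℝ) :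
    dist (charPoint g y s) (charPoint g y t) = |s - t| := by
  have h1 : ‖‖∇ g y‖⁻¹ • ∇ g y‖ = 1 := norm_smul_inv_norm h0
  rw [dist_eq_norm, charPoint, charPoint, add_sub_add_left_eq_sub, ← sub_smul, norm_smul, h1,
    mul_one, Real.norm_eq_abs]

theorem charPoint_zero (g : EuclideanSpace ℝ (Fin n) → ℝ) (y : EuclideanSpace ℝ (Fin n)) :
    charPoint g y 0 = y := by simp [charPoint]

theorem mem_closedBall_charPoint (g : EuclideanSpace ℝ (Fin n) → ℝ)
    (y : EuclideanSpace ℝ (Fin n)) (ht : 0 ≤ t) : y ∈ closedBall (charPoint g y t) t := by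
  by_cases h0 : ∇ g y = 0
  · simpa [charPoint, h0] using ht
  · have h := dist_charPoint h0 0 t
    rw [charPoint_zero, zero_sub, abs_neg, abs_of_nonneg ht] at h
    exact h.le

/-! ### Minimizers along a characteristic -/

/-- The balls around the points of the characteristic from `y` are nested, strictly so away
from `y`. -/
theorem mem_ball_charPoint (h0 : ∇ g y ≠ 0) (hst : s < t) (hz : z ∈ closedBall (charPoint g y s) s)
    (hzy : z ≠ y) : z ∈ ball (charPoint g y t) t := by
  have hs : 0 ≤ s := dist_nonneg.trans hz
  have h1 : ‖‖∇ g y‖⁻¹ • ∇ g y‖ = 1 := norm_smul_inv_norm h0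
  have hsq (r : ℝ) : dist z (charPoint g y r) ^ 2 =
      ‖z - y‖ ^ 2 - 2 * r * inner ℝ (z - y) (‖∇ g y‖⁻¹ • ∇ g y) + r ^ 2 := by
    rw [dist_eq_norm, charPoint, ← sub_sub, norm_sub_sq_real, inner_smul_right, norm_smul, h1,
      mul_one, Real.norm_eq_abs, sq_abs, mul_assoc]
  have hpos : 0 < ‖z - y‖ ^ 2 := by
    have := norm_pos_iff.2 (sub_ne_zero.2 hzy)
    positivity
  have h2 := pow_le_pow_left₀ dist_nonneg (mem_closedBall.1 hz) 2
  rw [hsq] at h2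
  have h3 : 0 < inner ℝ (z - y) (‖∇ g y‖⁻¹ • ∇ g y) := by
    by_contra! h
    nlinarith [mul_nonneg hs (neg_nonneg.2 h)]
  rw [mem_ball]
  refine lt_of_pow_lt_pow_left₀ 2 (hs.trans hst.le) ?_
  rw [hsq]
  nlinarith [mul_pos (sub_pos.2 hst) h3]

theorem mem_minimizers_charPoint_of_le (hg : Continuous g) (h0 : ∇ g y ≠ 0) (hs : 0 ≤ s)
    (hst : s ≤ t) (hy : y ∈ minimizers g (charPoint g y t) t) :
    y ∈ minimizers g (charPoint g y s) s := by
  rw [mem_minimizers_iff hg] at hy ⊢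
  refine ⟨mem_closedBall_charPoint g y hs, fun z hz => hy.2 z (closedBall_subset_closedBall' ?_ hz)⟩
  rw [dist_charPoint h0, abs_sub_comm, abs_of_nonneg (sub_nonneg.2 hst)]
  linarith

/-- If `y` stays a minimizer up to time `t`, then any competing minimizer at an earlier time is
interior to the ball at time `t`, hence a critical point. -/
theorem gradient_eq_zero_of_mem_minimizers_charPoint (hg : ContDiff ℝ 1 g) (h0 : ∇ g y ≠ 0)
    (hst : s < t) (hy : y ∈ minimizers g (charPoint g y t) t)
    (hz : z ∈ minimizers g (charPoint g y s) s) (hzy : z ≠ y) : ∇ g z = 0 := by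
  have hs : 0 ≤ s := dist_nonneg.trans hz.1
  have hys := mem_minimizers_charPoint_of_le hg.continuous h0 hs hst.le hy
  have hb := mem_ball_charPoint h0 hst hz.1 hzy
  exact gradient_eq_zero_of_mem_ball hg
    ⟨ball_subset_closedBall hb, hy.2.trans (hys.2.symm.trans hz.2)⟩ hb

/-- The time `t` may equal the second termination time, or `0`. -/
theorem mem_minimizers_of_le_secondTerminationTime (hg : Continuous g) {t : ℝ≥0}
    (ht : (t : ℝ≥0∞) ≤ secondTerminationTime g y) : y ∈ minimizers g (charPoint g y t) t := by
  have hlt {s : ℝ≥0} (hs : 0 < s) (hst : s < t) : y ∈ minimizers g (charPoint g y s) s := by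
    by_contra h
    exact notMem_of_lt_csInf' ((ENNReal.coe_lt_coe.2 hst).trans_le ht) ⟨s, rfl, hs, h⟩
  rcases eq_or_ne t 0 with rfl | ht0
  · rw [mem_minimizers_iff hg]
    refine ⟨mem_closedBall_charPoint g y le_rfl, fun z hz => ?_⟩
    rw [NNReal.coe_zero, charPoint_zero, closedBall_zero, Set.mem_singleton_iff] at hz
    rw [hz]
  have htpos : (0 : ℝ) < t := NNReal.coe_pos.2 (pos_iff_ne_zero.2 ht0)
  rw [mem_minimizers_iff hg]
  refine ⟨mem_closedBall_charPoint g y t.coe_nonneg, fun z hz => ?_⟩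
  obtain ⟨v, hv, rfl⟩ := (closedBall_eq_image _ t.coe_nonneg ▸ hz :)
  -- `g y ≤ g (charPoint g y s + s • v)` for `s < t`; let `s → t`
  have hcont : Continuous fun s : ℝ => g (charPoint g y s + s • v) := by
    unfold charPoint; fun_prop
  refine ge_of_tendsto (x := 𝓝[<] (t : ℝ)) hcont.continuousWithinAt ?_
  filter_upwards [Ioo_mem_nhdsLT htpos] with s hs
  lift s to ℝ≥0 using hs.1.le
  refine ((mem_minimizers_iff hg).1 (hlt (NNReal.coe_pos.1 hs.1) (NNReal.coe_lt_coe.1 hs.2))).2 _ ?_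
  rw [closedBall_eq_image _ s.coe_nonneg]
  exact ⟨v, hv, rfl⟩

theorem le_secondTerminationTime (hg : Continuous g) (h0 : ∇ g y ≠ 0) {t : ℝ≥0}
    (hy : y ∈ minimizers g (charPoint g y t) t) : (t : ℝ≥0∞) ≤ secondTerminationTime g y := by
  refine le_sInf ?_
  rintro _ ⟨s, rfl, -, hs⟩
  by_contra! h
  exact hs (mem_minimizers_charPoint_of_le hg h0 s.coe_nonneg
    (NNReal.coe_le_coe.2 (ENNReal.coe_lt_coe.1 h).le) hy)

theorem exists_ne_mem_minimizers_of_firstTerminationTime_lt (hg : Continuous g) {t : ℝ≥0}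
    (ht : firstTerminationTime g y < t) : ∃ z ∈ minimizers g (charPoint g y t) t, z ≠ y := by
  by_contra! h
  have heq : minimizers g (charPoint g y t) t = {y} :=
    Set.eq_singleton_iff_nonempty_unique_mem.2 ⟨minimizers_nonempty hg t.coe_nonneg, h⟩
  exact ht.not_ge (le_sSup ⟨t, rfl, ENNReal.coe_pos.1 (bot_le.trans_lt ht), heq⟩)

/-- Critical minimizers do not appear suddenly: the property of having none is open in
`ℝⁿ × [0, ∞)`. -/
theorem eventually_forall_mem_minimizers_gradient_ne_zero (hg : ContDiff ℝ 1 g) (ht : 0 ≤ t)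
    (h : ∀ y ∈ minimizers g x t, ∇ g y ≠ 0) :
    ∀ᶠ p : EuclideanSpace ℝ (Fin n) × ℝ in 𝓝[{p | 0 ≤ p.2}] (x, t),
      ∀ y ∈ minimizers g p.1 p.2, ∇ g y ≠ 0 := by
  have hgc := hg.continuous
  have hev : ∀ᶠ p : EuclideanSpace ℝ (Fin n) × ℝ in 𝓝 (x, t), ∀ v ∈ closedBall 0 1,
      ¬ (sInf ((fun v => g (p.1 + p.2 • v)) '' closedBall 0 1) = g (p.1 + p.2 • v) ∧
        ∇ g (p.1 + p.2 • v) = 0) := by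
    refine (isCompact_closedBall _ _).eventually_forall_of_forall_eventually fun v hv => ?_
    have hclosed : IsClosed {z : (EuclideanSpace ℝ (Fin n) × ℝ) × EuclideanSpace ℝ (Fin n) |
        sInf ((fun v => g (z.1.1 + z.1.2 • v)) '' closedBall 0 1) = g (z.1.1 + z.1.2 • z.2) ∧
        ∇ g (z.1.1 + z.1.2 • z.2) = 0} :=
      (isClosed_eq ((continuous_sInf_unitBall hgc).comp continuous_fst) (by fun_prop)).inter
        (isClosed_eq ((continuous_gradient hg).comp (by fun_prop)) continuous_const)
    refine hclosed.isOpen_compl.mem_nhds fun hz => h (x + t • v) ⟨?_, ?_⟩ hz.2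
    · rw [closedBall_eq_image x ht]
      exact ⟨v, hv, rfl⟩
    · rw [hopfLax_eq_sInf x ht]
      exact hz.1
  filter_upwards [nhdsWithin_le_nhds hev, self_mem_nhdsWithin] with p hp hp0 y hy h0
  obtain ⟨v, hv, rfl⟩ := (closedBall_eq_image p.1 hp0 ▸ hy.1 :)
  exact hp v hv ⟨(hopfLax_eq_sInf p.1 hp0).symm.trans hy.2, h0⟩

/-! ### Differentiable points -/

/-- This includes `t = 0`, where the spatial gradient is `∇ g x` and the time derivative is
`-‖∇ g x‖`. -/
theorem isDifferentiablePoint_of_minimizers_eq_singleton (hg : ContDiff ℝ 1 g) (ht : 0 ≤ t)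
    (h : minimizers g x t = {y}) : IsDifferentiablePoint g x t := by
  have hgc := hg.continuous
  set f : EuclideanSpace ℝ (Fin n) × ℝ → EuclideanSpace ℝ (Fin n) → ℝ :=
    fun p v => g (p.1 + p.2 • v) with hf
  set f' : EuclideanSpace ℝ (Fin n) × ℝ → EuclideanSpace ℝ (Fin n) →
      (EuclideanSpace ℝ (Fin n) × ℝ) →L[ℝ] ℝ := fun p v =>
    (fderiv ℝ g (p.1 + p.2 • v)).comp
      (ContinuousLinearMap.fst ℝ _ ℝ + (ContinuousLinearMap.snd ℝ _ ℝ).smulRight v) with hf'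
  have hd : ∀ q v, HasFDerivAt (fun q => f q v) (f' q v) q := fun q v =>
    (hg.differentiable one_ne_zero _).hasFDerivAt.comp q
      (hasFDerivAt_fst.add (hasFDerivAt_snd.smul_const v))
  have hfc : Continuous ↿f := by
    simp only [hf, Function.HasUncurry.uncurry, id]; fun_prop
  have hfc' : Continuous ↿f' := by
    simp only [hf', Function.HasUncurry.uncurry, id]
    refine ((hg.continuous_fderiv one_ne_zero).comp (by fun_prop)).clm_comp
      (continuous_const.add ?_)
    exact (ContinuousLinearMap.smulRightL ℝ (EuclideanSpace ℝ (Fin n) × ℝ)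
      (EuclideanSpace ℝ (Fin n)) (ContinuousLinearMap.snd ℝ _ ℝ)).continuous.comp
      continuous_snd
  have hmem (v) (hv : v ∈ closedBall 0 1) : x + t • v = y ↔
      f (x, t) v = sInf (f (x, t) '' closedBall 0 1) := by
    rw [← Set.mem_singleton_iff, ← h, eq_comm, ← hopfLax_eq_sInf x ht]
    refine ⟨fun hy => hy.2, fun hy => ⟨?_, hy⟩⟩
    rw [closedBall_eq_image x ht]
    exact ⟨v, hv, rfl⟩
  suffices H : ∃ v₀ ∈ closedBall (0 : EuclideanSpace ℝ (Fin n)) 1, x + t • v₀ = y ∧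
      ∀ v ∈ closedBall 0 1, x + t • v = y → ∀ q ∈ {p : EuclideanSpace ℝ (Fin n) × ℝ | 0 ≤ p.2},
        f' (x, t) v₀ (q - (x, t)) ≤ f' (x, t) v (q - (x, t)) by
    obtain ⟨v₀, hv₀, hy, hge⟩ := H
    have := hasFDerivWithinAt_sInf_image (isCompact_closedBall _ _) hfc hfc' hd hv₀
      ((hmem v₀ hv₀).1 hy) rfl fun v hv hvm => hge v hv ((hmem v hv).2 hvm)
    exact this.differentiableWithinAt.congr (fun p hp => hopfLax_eq_sInf p.1 hp)
      (hopfLax_eq_sInf x ht)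
  rcases ht.eq_or_lt with rfl | htpos
  · -- at `t = 0` every `v` gives the minimizer; the steepest descent direction gives the least
    -- time derivative
    have hxy : x = y := by
      have hy : y ∈ minimizers g x 0 := h ▸ Set.mem_singleton y
      simpa [eq_comm] using hy.1
    subst hxy
    have hnorm : ‖-(‖∇ g x‖⁻¹ • ∇ g x)‖ ≤ 1 := by
      rw [norm_neg, norm_smul, norm_inv, norm_norm]
      exact inv_mul_le_one
    refine ⟨-(‖∇ g x‖⁻¹ • ∇ g x), by simpa using hnorm, by simp, fun v hv _ q hq => ?_⟩
    have hv1 : ‖v‖ ≤ 1 := by simpa using hv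
    have h1 : -‖∇ g x‖ ≤ fderiv ℝ g x v := by
      rw [← inner_gradient_left]
      have := (abs_le.1 (abs_real_inner_le_norm (∇ g x) v)).1
      nlinarith [norm_nonneg (∇ g x)]
    have h2 : fderiv ℝ g x (-(‖∇ g x‖⁻¹ • ∇ g x)) = -‖∇ g x‖ := by
      rw [← inner_gradient_left, inner_neg_right,
        inner_smul_right, real_inner_self_eq_norm_sq, pow_two, ← mul_assoc, neg_inj]
      rcases eq_or_ne ‖∇ g x‖ 0 with h0 | h0
      · simp [h0]
      · rw [inv_mul_cancel₀ h0, one_mul]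
    have h3 := mul_le_mul_of_nonneg_left (h2.trans_le h1) hq
    simpa [hf'] using h3
  · obtain ⟨v₀, hv₀, hy⟩ : y ∈ (fun v => x + t • v) '' closedBall 0 1 := by
      rw [← closedBall_eq_image x ht]
      exact (h ▸ Set.mem_singleton y : y ∈ minimizers g x t).1
    refine ⟨v₀, hv₀, hy, fun v _ hvy q _ => ?_⟩
    rw [smul_right_injective _ htpos.ne' (add_left_cancel (hvy.trans hy.symm))]

/-- At a differentiable point, the spatial gradient of `u` is the gradient of `g` at every
minimizer, because `g (· + (y - x))` touches `u(·, t)` from above at `x`. -/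
theorem IsDifferentiablePoint.hasGradientAt (hg : ContDiff ℝ 1 g) (ht : 0 ≤ t)
    (hd : IsDifferentiablePoint g x t) (hy : y ∈ minimizers g x t) :
    HasGradientAt (fun x => hopfLax g x t) (∇ g y) x := by
  have hslice : DifferentiableAt ℝ (fun x => hopfLax g x t) x := by
    rw [← differentiableWithinAt_univ]
    exact DifferentiableWithinAt.comp (t := {p : EuclideanSpace ℝ (Fin n) × ℝ | 0 ≤ p.2})
      (g := fun p : EuclideanSpace ℝ (Fin n) × ℝ => hopfLax g p.1 p.2) (f := fun x => (x, t)) x hd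
      (by fun_prop) fun _ _ => ht
  have hshift : HasFDerivAt (fun x' => g (x' + (y - x))) (fderiv ℝ g y) x := by
    rw [hasFDerivAt_comp_add_right, add_sub_cancel]
    exact (hg.differentiable one_ne_zero y).hasFDerivAt
  have hmax : IsLocalMax (fun x' => hopfLax g x' t - g (x' + (y - x))) x := by
    refine Filter.Eventually.of_forall fun x' => ?_
    have h1 : hopfLax g x' t ≤ g (x' + (y - x)) :=
      hopfLax_le hg.continuous (by simpa [dist_eq_norm] using hy.1)
    simpa [hy.2] using h1
  have h0 := hmax.hasFDerivAt_eq_zero (hslice.hasFDerivAt.sub hshift)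
  rw [hasGradientAt_iff_hasFDerivAt, toDual_gradient, ← sub_eq_zero.1 h0]
  exact hslice.hasFDerivAt

/-- At a differentiable point a noncritical minimizer is the only minimizer: all minimizers have
the same gradient, which determines the characteristic through `(x, t)` and its starting point. -/
theorem IsDifferentiablePoint.minimizers_eq_singleton (hg : ContDiff ℝ 1 g) (ht : 0 ≤ t)
    (hd : IsDifferentiablePoint g x t) (hy : y ∈ minimizers g x t) (h0 : ∇ g y ≠ 0) :
    minimizers g x t = {y} := by
  refine Set.eq_singleton_iff_unique_mem.2 ⟨hy, fun z hz => ?_⟩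
  have hyz : ∇ g z = ∇ g y := (hd.hasGradientAt hg ht hz).unique (hd.hasGradientAt hg ht hy)
  have hchar := (eq_charPoint_of_mem_minimizers hg hz (hyz ▸ h0)).symm.trans
    (eq_charPoint_of_mem_minimizers hg hy h0)
  rw [charPoint, charPoint, hyz] at hchar
  exact add_right_cancel hchar

/-! ### Propagation of nondifferentiable points -/

/-- If all points at time `t + ε` over the ball of radius `ε` around `x` are differentiable with
noncritical minimizers, then maximizing `u(·, t + ε)` over that ball recovers at least
`u(x, t)`. -/
theorem exists_hopfLax_le_of_forall_isDifferentiablePoint (hg : ContDiff ℝ 1 g) (ht : 0 ≤ t)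
    {ε : ℝ} (hε : 0 < ε) (hd : ∀ x' ∈ ball x ε, IsDifferentiablePoint g x' (t + ε))
    (hc : ∀ x' ∈ ball x ε, ∀ y ∈ minimizers g x' (t + ε), ∇ g y ≠ 0) :
    ∃ x' ∈ closedBall x ε, hopfLax g x t ≤ hopfLax g x' (t + ε) := by
  have hu := continuousOn_hopfLax hg.continuous
  have htε : 0 ≤ t + ε := by positivity
  have hux : Continuous fun x' => hopfLax g x' (t + ε) :=
    hu.comp_continuous (f := fun x' => (x', t + ε)) (by fun_prop) fun _ => htε
  obtain ⟨xm, hxm, hmax⟩ := (isCompact_closedBall x ε).exists_isMaxOn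
    (nonempty_closedBall.2 hε.le) hux.continuousOn
  refine ⟨xm, hxm, ?_⟩
  have hcont : ContinuousWithinAt (fun r => hopfLax g x (t + ε - r)) (Set.Iio ε) ε :=
    ContinuousWithinAt.comp (t := {p : EuclideanSpace ℝ (Fin n) × ℝ | 0 ≤ p.2})
      (g := fun p : EuclideanSpace ℝ (Fin n) × ℝ => hopfLax g p.1 p.2)
      (f := fun r => (x, t + ε - r)) (hu _ (by simpa using ht)) (by fun_prop)
      fun r hr => by
        have : r < ε := hr
        show 0 ≤ t + ε - r
        linarith
  have hlim : Tendsto (fun r => hopfLax g x (t + ε - r)) (𝓝[<] ε) (𝓝 (hopfLax g x t)) := by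
    simpa using hcont.tendsto
  refine le_of_tendsto hlim ?_
  filter_upwards [Ioo_mem_nhdsLT hε] with r hr
  obtain ⟨xr, hxr, hmaxr⟩ := (isCompact_closedBall x r).exists_isMaxOn
    (nonempty_closedBall.2 hr.1.le) hux.continuousOn
  have hxrε : xr ∈ ball x ε := closedBall_subset_ball hr.2 hxr
  obtain ⟨y, hy⟩ := minimizers_nonempty (x := xr) hg.continuous htε
  have h0 := hc xr hxrε y hy
  -- the gradient at the maximum point `xr` of `u(·, t + ε)` over the ball of radius `r` is
  -- radial, so the characteristic from `y` to `xr` passes through `x` at time `t + ε - r`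
  have hgrad : HasGradientAt (fun x' => -hopfLax g x' (t + ε)) (-∇ g y) xr := by
    rw [hasGradientAt_iff_hasFDerivAt, map_neg]
    exact ((hd xr hxrε).hasGradientAt hg htε hy).hasFDerivAt.neg
  have hx1 := eq_add_of_isMinOn_closedBall hgrad (neg_ne_zero.2 h0) hxr hmaxr.neg
  have hx2 := eq_charPoint_of_mem_minimizers hg hy h0
  have hx : x = charPoint g y (t + ε - r) := by
    rw [hx1, hx2, charPoint, charPoint, norm_neg, sub_smul, smul_neg, smul_neg]
    abel
  have hyx : y ∈ closedBall x (t + ε - r) := by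
    rw [hx]
    exact mem_closedBall_charPoint g y (by linarith [hr.2])
  calc hopfLax g x (t + ε - r) ≤ g y := hopfLax_le hg.continuous hyx
    _ = hopfLax g xr (t + ε) := hy.2.symm
    _ ≤ hopfLax g xm (t + ε) := hmax (ball_subset_closedBall hxrε)

end Eikonal
open Eikonal in
theorem proposition3 (n : ℕ) (g : EuclideanSpace ℝ (Fin n) → ℝ) (hg : ContDiff ℝ 1 g)
    (y₀ : EuclideanSpace ℝ (Fin n)) (hy₀ : ∇ g y₀ ≠ 0)
    (hfin : Eikonal.firstTerminationTime g y₀ < ⊤) :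
    (∀ tₛ : ℝ, tₛ = (Eikonal.secondTerminationTime g y₀).toReal →
      ∀ xₛ : EuclideanSpace ℝ (Fin n), xₛ = Eikonal.charPoint g y₀ tₛ →
      Eikonal.firstTerminationTime g y₀ = Eikonal.secondTerminationTime g y₀ →
        (((∃ y, Eikonal.minimizers g xₛ tₛ = {y}) ∧ Eikonal.IsDifferentiablePoint g xₛ tₛ) ∨
          ((Eikonal.minimizers g xₛ tₛ).Nontrivial ∧ ¬ Eikonal.IsDifferentiablePoint g xₛ tₛ)) ∧
        ((Eikonal.IsDifferentiablePoint g xₛ tₛ ∨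
            (¬ Eikonal.IsDifferentiablePoint g xₛ tₛ ∧
              ∀ y ∈ Eikonal.minimizers g xₛ tₛ, ∇ g y ≠ 0)) →
          ∃ h : ℝ, 0 < h ∧ ∀ ε ∈ Set.Ioc 0 h, ∃ x ∈ Metric.ball xₛ ε,
            ¬ Eikonal.IsDifferentiablePoint g x (tₛ + ε))) ∧
    (Eikonal.firstTerminationTime g y₀ < Eikonal.secondTerminationTime g y₀ →
      ∀ t : ℝ≥0,
        (t : ℝ≥0∞) ∈ Set.Icc (Eikonal.firstTerminationTime g y₀)
          (Eikonal.secondTerminationTime g y₀) →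
        ¬ Eikonal.IsDifferentiablePoint g (Eikonal.charPoint g y₀ t) t) := by
  have hgc := hg.continuous
  refine ⟨?_, fun hlt t ht hd => ?_⟩
  · rintro t rfl x rfl heq
    have hT : ((secondTerminationTime g y₀).toNNReal : ℝ≥0∞) = secondTerminationTime g y₀ :=
      ENNReal.coe_toNNReal (heq ▸ hfin).ne
    rw [ENNReal.toReal]
    set t := (secondTerminationTime g y₀).toNNReal
    have hy := mem_minimizers_of_le_secondTerminationTime hgc hT.le
    refine ⟨?_, fun hcases => ?_⟩
    · by_cases hs : minimizers g (charPoint g y₀ t) t = {y₀}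
      · exact Or.inl ⟨⟨y₀, hs⟩, isDifferentiablePoint_of_minimizers_eq_singleton hg t.coe_nonneg hs⟩
      · refine Or.inr ⟨?_, fun hd => hs (hd.minimizers_eq_singleton hg t.coe_nonneg hy hy₀)⟩
        exact (Set.nontrivial_iff_ne_singleton hy).2 hs
    · have hne : ∀ y ∈ minimizers g (charPoint g y₀ t) t, ∇ g y ≠ 0 := by
        rcases hcases with hd | h
        · rw [hd.minimizers_eq_singleton hg t.coe_nonneg hy hy₀]
          rintro y rfl
          exact hy₀
        · exact h.2
      obtain ⟨ρ, hρ, hball⟩ := Metric.mem_nhdsWithin_iff.1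
        (eventually_forall_mem_minimizers_gradient_ne_zero hg t.coe_nonneg hne)
      refine ⟨ρ / 2, by positivity, fun ε hε => ?_⟩
      by_contra! hd
      have htε : (0 : ℝ) ≤ t + ε := add_nonneg t.coe_nonneg hε.1.le
      have hc : ∀ x ∈ Metric.ball (charPoint g y₀ t) ε, ∀ y ∈ minimizers g x (t + ε),
          ∇ g y ≠ 0 := by
        intro x hx
        refine hball (a := (x, (t : ℝ) + ε)) ⟨?_, htε⟩
        have h1 : dist x (charPoint g y₀ t) < ε := hx
        have h2 : |ε| = ε := abs_of_pos hε.1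
        rw [Metric.mem_ball, Prod.dist_eq, max_lt_iff]
        refine ⟨?_, ?_⟩
        · linarith [hε.2]
        · rw [Real.dist_eq, add_sub_cancel_left, h2]
          linarith [hε.2]
      obtain ⟨x', hx', hle⟩ :=
        exists_hopfLax_le_of_forall_isDifferentiablePoint hg t.coe_nonneg hε.1 hd hc
      -- `y₀` is a minimizer for `(x', t + ε)`, so its characteristic survives up to `t + ε`
      have hy' : y₀ ∈ minimizers g x' (t + ε) := by
        have hmem : y₀ ∈ Metric.closedBall x' (t + ε) := by
          refine Metric.closedBall_subset_closedBall' ?_ hy.1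
          rw [dist_comm]
          exact add_le_add_right hx' _
        exact ⟨hmem, le_antisymm (hopfLax_le hgc hmem) (hy.2 ▸ hle)⟩
      have hx := eq_charPoint_of_mem_minimizers hg hy' hy₀
      subst hx
      lift ε to ℝ≥0 using hε.1.le
      have hcontra := le_secondTerminationTime (t := t + ε) hgc hy₀ hy'
      rw [← hT, ENNReal.coe_le_coe, ← NNReal.coe_le_coe, NNReal.coe_add] at hcontra
      linarith [hε.1]
  · have hy := mem_minimizers_of_le_secondTerminationTime hgc ht.2
    have hs := hd.minimizers_eq_singleton hg t.coe_nonneg hy hy₀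
    rcases ht.1.lt_or_eq with hlt' | heq
    · obtain ⟨z, hz, hzy⟩ := exists_ne_mem_minimizers_of_firstTerminationTime_lt hgc hlt'
      rw [hs] at hz
      exact hzy hz
    · -- just after `t` there are critical minimizers, hence also at time `t`
      have hne : ∀ y ∈ minimizers g (charPoint g y₀ t) t, ∇ g y ≠ 0 := by
        rw [hs]
        rintro y rfl
        exact hy₀
      have hev := eventually_forall_mem_minimizers_gradient_ne_zero hg t.coe_nonneg hne
      have hcont : Continuous fun s : ℝ≥0 => (charPoint g y₀ s, (s : ℝ)) := by
        unfold charPoint; fun_prop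
      have hev' : ∀ᶠ s : ℝ≥0 in nhds t, ∀ y ∈ minimizers g (charPoint g y₀ s) s, ∇ g y ≠ 0 :=
        (tendsto_nhdsWithin_iff.2 ⟨hcont.tendsto t,
          Filter.Eventually.of_forall fun s => s.coe_nonneg⟩).eventually hev
      rw [heq] at hlt
      obtain ⟨b, htb, hb⟩ := ENNReal.lt_iff_exists_nnreal_btwn.1 hlt
      have htb' := ENNReal.coe_lt_coe.1 htb
      obtain ⟨s, hs', hst⟩ := ((hev'.filter_mono nhdsWithin_le_nhds).and
        (Ioo_mem_nhdsGT htb')).exists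
      obtain ⟨z, hz, hzy⟩ := exists_ne_mem_minimizers_of_firstTerminationTime_lt (y := y₀) hgc
        (heq ▸ ENNReal.coe_lt_coe.2 hst.1)
      exact hs' z hz (gradient_eq_zero_of_mem_minimizers_charPoint hg hy₀
        (NNReal.coe_lt_coe.2 hst.2) (mem_minimizers_of_le_secondTerminationTime hgc hb.le) hz hzy)
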